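/- Let $G$ be a compact Hausdorff abelian topological group, written additively, with Haar probability measure $\mu$. For a positive integer $n$ and $A\subseteq G$, let $nA=\{a_1+\cdots+a_n : a_1,\dots,a_n\in A\}$ be the $n$-fold Minkowski sum of $A$ with itself. For integers $1\le k<\ell$ define $$\lambda_{k,\ell}(G)=\sup\{\mu(A) : A\subseteq G \text{ measurable},\ kA\cap \ell A=\emptyset\}.$$ If $G$ is connected and nontrivial, then for all integers $1\le k<\ell$, $$\lambda_{k,\ell}(G)\ \ge\ \frac{1}{k+\ell}.$$ -/

import Mathlib

open MeasureTheory TopologicalSpace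

noncomputable section

/-- The `k`-fold Minkowski sum `kA = A + ⋯ + A` (not the dilation `{k • a | a ∈ A}`). -/
def kFoldSum {G : Type*} [AddCommGroup G] (k : ℕ) (A : Set G) : Set G :=
  {x | ∃ a : Fin k → G, (∀ i, a i ∈ A) ∧ ∑ i, a i = x}

/-- `A` is `(k, l)`-sum-free if `kA ∩ lA = ∅`. -/
def IsSumFree {G : Type*} [AddCommGroup G] (k l : ℕ) (A : Set G) : Prop :=
  kFoldSum k A ∩ kFoldSum l A = ∅

/-- The Haar probability measure of a compact group: the regular Haar measure for which the
whole group has measure `1`. -/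
def haarProb (G : Type*) [AddCommGroup G] [TopologicalSpace G] [IsTopologicalAddGroup G]
    [CompactSpace G] [MeasurableSpace G] [BorelSpace G] : Measure G :=
  Measure.addHaarMeasure (⊤ : PositiveCompacts G)

/-- `λ_{k,l}(G) = sup {μ(A) : A ⊆ G measurable, kA ∩ lA = ∅}`, with `μ` the Haar probability
measure. For `1 ≤ k`, the set of values contains `0` (take `A = ∅`), and it is bounded by `1`. -/
def sumFreeDensity (k l : ℕ) (G : Type*) [AddCommGroup G] [TopologicalSpace G]
    [IsTopologicalAddGroup G] [CompactSpace G] [MeasurableSpace G] [BorelSpace G] : ℝ :=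
  sSup {r : ℝ | ∃ A : Set G, MeasurableSet A ∧ IsSumFree k l A ∧ r = (haarProb G).real A}

end

/-! A nontrivial continuous character has a compact connected image that is not a point, so it maps
`G` onto ℝ/ℤ and carries Haar measure to Haar measure. It then suffices to find a sum-free arc of
length d = 1/(k+l) in the circle and pull it back. For (a, a+d) with la = k(a+d), the sums lie in
(ka, k(a+d)) and (la, l(a+d)), adjacent open intervals of total length 1, hence disjoint mod 1. The
character comes from translation on L²(G), by Gelfand theory on the bicommutant
(`exists_character`). -/

set_option linter.unusedSectionVars false

/-! ### Characters from unitary representations -/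

section Rep
variable {G H : Type*} [AddCommGroup G] [TopologicalSpace G] [IsTopologicalAddGroup G]
  [CompactSpace G] [MeasurableSpace G] [BorelSpace G]
  [NormedAddCommGroup H] [InnerProductSpace ℂ H] [CompleteSpace H]

/-- A strongly continuous unitary representation of `G` on the Hilbert space `H`. -/
structure IsUnitaryRep (T : G → H →L[ℂ] H) : Prop where
  map_zero : T 0 = 1
  map_add : ∀ a b, T (a + b) = T a * T b
  norm_map : ∀ a v, ‖T a v‖ = ‖v‖
  continuous_apply : ∀ v, Continuous fun a => T a v

namespace IsUnitaryRep

variable {T : G → H →L[ℂ] H}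

theorem commute (hT : IsUnitaryRep T) (a b : G) : Commute (T a) (T b) := by
  rw [Commute, SemiconjBy, ← hT.map_add, ← hT.map_add, add_comm]

theorem star_mul_self (hT : IsUnitaryRep T) (a : G) : star (T a) * T a = 1 :=
  (ContinuousLinearMap.norm_map_iff_adjoint_comp_self (T a)).1 (hT.norm_map a)

theorem star_eq (hT : IsUnitaryRep T) (a : G) : star (T a) = T (-a) := by
  have h : T a * T (-a) = 1 := by rw [← hT.map_add, add_neg_cancel, hT.map_zero]
  calc star (T a) = star (T a) * (T a * T (-a)) := by rw [h, mul_one]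
    _ = T (-a) := by rw [← mul_assoc, hT.star_mul_self, one_mul]

variable (μ : Measure G) [IsProbabilityMeasure μ]

theorem integrable_smul (hT : IsUnitaryRep T) (f : C(G, ℂ)) (v : H) :
    Integrable (fun a => f a • T a v) μ :=
  (f.continuous.smul (hT.continuous_apply v)).integrable_of_hasCompactSupport
    (HasCompactSupport.of_compactSpace _)

theorem norm_integral_le (hT : IsUnitaryRep T) (f : C(G, ℂ)) (v : H) : ‖∫ a, f a • T a v ∂μ‖ ≤ ‖f‖ * ‖v‖ := by
  have := norm_integral_le_of_norm_le_const (μ := μ) (f := fun a => f a • T a v)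
    (C := ‖f‖ * ‖v‖) (.of_forall fun a => by
      rw [norm_smul, hT.norm_map]
      gcongr
      exact f.norm_coe_le_norm a)
  simpa using this

/-- The operator `v ↦ ∫ f(a) T(a) v da` obtained by integrating a unitary representation. -/
noncomputable def integrated (hT : IsUnitaryRep T) (f : C(G, ℂ)) : H →L[ℂ] H :=
  LinearMap.mkContinuous
    { toFun := fun v => ∫ a, f a • T a v ∂μ
      map_add' := fun v w => by
        simp only [_root_.map_add, smul_add]
        exact integral_add (hT.integrable_smul μ f v) (hT.integrable_smul μ f w)
      map_smul' := fun c v => by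
        simp only [map_smul, RingHom.id_apply, smul_comm _ c]
        exact integral_smul c _ }
    ‖f‖ (hT.norm_integral_le μ f)

theorem integrated_apply (hT : IsUnitaryRep T) (f : C(G, ℂ)) (v : H) :
    hT.integrated μ f v = ∫ a, f a • T a v ∂μ := rfl

theorem integrated_sub (hT : IsUnitaryRep T) (f g : C(G, ℂ)) :
    hT.integrated μ (f - g) = hT.integrated μ f - hT.integrated μ g := by
  ext v
  simp only [integrated_apply, ContinuousMap.sub_apply, sub_smul, _root_.sub_apply]
  exact integral_sub (hT.integrable_smul μ f v) (hT.integrable_smul μ g v)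

theorem norm_integrated_le (hT : IsUnitaryRep T) (f : C(G, ℂ)) : ‖hT.integrated μ f‖ ≤ ‖f‖ :=
  LinearMap.mkContinuous_norm_le _ (norm_nonneg f) _

theorem commute_integrated (hT : IsUnitaryRep T) (f : C(G, ℂ)) {S : H →L[ℂ] H} (hS : ∀ a, Commute S (T a)) :
    Commute S (hT.integrated μ f) := by
  ext v
  change S (hT.integrated μ f v) = hT.integrated μ f (S v)
  rw [integrated_apply, integrated_apply,
    ← S.integral_comp_comm (hT.integrable_smul μ f v)]
  refine integral_congr_ae (.of_forall fun a => ?_)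
  simp only [map_smul]
  congr 1
  exact congrArg (fun R : H →L[ℂ] H => R v) (hS a)

theorem mul_integrated (hT : IsUnitaryRep T) [μ.IsAddLeftInvariant] (f : C(G, ℂ)) (b : G) :
    T b * hT.integrated μ f =
      hT.integrated μ (f.comp ⟨fun a => -b + a, by fun_prop⟩) := by
  ext v
  change T b (hT.integrated μ f v) = _
  rw [integrated_apply, integrated_apply,
    ← (T b).integral_comp_comm (hT.integrable_smul μ f v),
    ← integral_add_left_eq_self (μ := μ)
      (fun a => (f.comp ⟨fun a => -b + a, by fun_prop⟩) a • T a v) b]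
  refine integral_congr_ae (.of_forall fun a => ?_)
  simp [hT.map_add]

/-- Averaging upgrades strong continuity of `T` to norm continuity: translates of `f` vary
continuously in the sup norm. -/
theorem continuous_mul_integrated (hT : IsUnitaryRep T) [μ.IsAddLeftInvariant] (f : C(G, ℂ)) :
    Continuous fun b => T b * hT.integrated μ f := by
  let F : C(G, C(G, ℂ)) :=
    (ContinuousMap.mk (fun p : G × G => f (-p.1 + p.2)) (by fun_prop)).curry
  have hF : ∀ b, T b * hT.integrated μ f = hT.integrated μ (F b) := fun b => by
    rw [hT.mul_integrated μ f b]; rfl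
  simp only [hF]
  refine LipschitzWith.continuous (K := 1) (f := hT.integrated μ) ?_ |>.comp F.continuous
  refine LipschitzWith.of_dist_le_mul fun f g => ?_
  rw [dist_eq_norm, dist_eq_norm, ← hT.integrated_sub μ, NNReal.coe_one, one_mul]
  exact hT.norm_integrated_le μ _

theorem exists_mul_integrated_ne (hT : IsUnitaryRep T) [μ.IsOpenPosMeasure] {a₀ : G} (ha₀ : T a₀ ≠ 1) :
    ∃ f : C(G, ℂ), T a₀ * hT.integrated μ f ≠ hT.integrated μ f := by
  obtain ⟨v, hv⟩ : ∃ v, T a₀ v ≠ v := by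
    by_contra! h
    exact ha₀ (ContinuousLinearMap.ext h)
  set w := T a₀ v - v with hw
  -- `L` kills every vector fixed by `T a₀`. With `f` the conjugate of `L (T a v)`, applying `L` to
  -- the average gives ∫ |L (T a v)|², positive because L v = ‖w‖² ≠ 0.
  let L : H →L[ℂ] ℂ := (innerSL ℂ w).comp (T a₀ - 1)
  have hLc : Continuous fun a => L (T a v) := L.continuous.comp (hT.continuous_apply v)
  refine ⟨⟨fun a => star (L (T a v)), hLc.star⟩, fun h => ?_⟩
  set f : C(G, ℂ) := ⟨fun a => star (L (T a v)), hLc.star⟩ with hf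
  have h0 : L (hT.integrated μ f v) = 0 := by
    have : T a₀ (hT.integrated μ f v) = hT.integrated μ f v :=
      congrArg (fun R : H →L[ℂ] H => R v) h
    simp [L, this]
  rw [integrated_apply, ← L.integral_comp_comm (hT.integrable_smul μ f v)] at h0
  have h1 : ∀ a, L (f a • T a v) = ((‖L (T a v)‖ ^ 2 : ℝ) : ℂ) := fun a => by
    rw [map_smul, smul_eq_mul]
    simpa [hf] using RCLike.conj_mul (L (T a v))
  simp only [h1] at h0
  rw [integral_complex_ofReal, Complex.ofReal_eq_zero] at h0
  have hc : Continuous fun a => ‖L (T a v)‖ ^ 2 := hLc.norm.pow 2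
  have hpos := hc.integral_pos_of_hasCompactSupport_nonneg_nonzero (μ := μ) (x := 0)
    (HasCompactSupport.of_compactSpace _) (fun a => by positivity) (by
      have : L v = (‖w‖ : ℂ) ^ 2 := inner_self_eq_norm_sq_to_K (𝕜 := ℂ) w
      have hw0 : w ≠ 0 := sub_ne_zero.2 hv
      simp [hT.map_zero, this, hw0])
  exact hpos.ne' h0

/-- The bicommutant of the commuting family `T` is a commutative C*-algebra, so some character ψ of
it separates `T a₀ * K` from `K`, where `K` is an average of `T`. -/
theorem exists_character (hT : IsUnitaryRep T) [μ.IsAddLeftInvariant] [μ.IsOpenPosMeasure] {a₀ : G} (ha₀ : T a₀ ≠ 1) :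
    ∃ χ : G → Circle, Continuous χ ∧ (∀ a b, χ (a + b) = χ a * χ b) ∧ χ a₀ ≠ 1 := by
  obtain ⟨f, hf⟩ := hT.exists_mul_integrated_ne μ ha₀
  let C : StarSubalgebra ℂ (H →L[ℂ] H) := StarSubalgebra.centralizer ℂ (Set.range T)
  let A : StarSubalgebra ℂ (H →L[ℂ] H) := StarSubalgebra.centralizer ℂ (C : Set (H →L[ℂ] H))
  have memC : ∀ S : H →L[ℂ] H, S ∈ C ↔ ∀ a, Commute S (T a) := fun S => by
    rw [StarSubalgebra.mem_centralizer_iff, Set.forall_mem_range]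
    refine ⟨fun h a => (h a).1.symm, fun h a => ⟨(h a).symm, ?_⟩⟩
    rw [hT.star_eq]
    exact (h (-a)).symm
  have memA : ∀ S : H →L[ℂ] H, S ∈ A ↔ ∀ R ∈ C, R * S = S * R := fun S => by
    rw [StarSubalgebra.mem_centralizer_iff]
    exact ⟨fun h R hR => (h R hR).1, fun h R hR => ⟨h R hR, h _ (star_mem hR)⟩⟩
  have TC : ∀ a, T a ∈ C := fun a => (memC _).2 (hT.commute a)
  have TA : ∀ a, T a ∈ A := fun a => (memA _).2 fun R hR => (memC R).1 hR a
  have KA : hT.integrated μ f ∈ A :=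
    (memA _).2 fun R hR => hT.commute_integrated μ f ((memC R).1 hR)
  have AC : A ≤ C := fun S hS => (memC S).2 fun a => ((memA S).1 hS _ (TC a)).symm
  have hclosed : IsClosed (A : Set (H →L[ℂ] H)) := Set.isClosed_centralizer _
  let : CStarAlgebra A := StarSubalgebra.cstarAlgebra A
  let : CommCStarAlgebra A :=
    { (inferInstance : CStarAlgebra A) with
      mul_comm := fun x y => Subtype.ext ((memA _).1 y.2 x (AC x.2)) }
  let t : G → A := fun a => ⟨T a, TA a⟩
  let K : A := ⟨hT.integrated μ f, KA⟩
  have tadd : ∀ a b, t (a + b) = t a * t b := fun a b => Subtype.ext (hT.map_add a b)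
  have hne : t a₀ * K - K ≠ 0 := fun h => hf (congrArg Subtype.val (sub_eq_zero.1 h))
  obtain ⟨ψ, hψ⟩ : ∃ ψ : WeakDual.characterSpace ℂ A, ψ (t a₀ * K - K) ≠ 0 := by
    by_contra! h
    refine hne ((gelfandTransform_isometry A).injective ?_)
    rw [_root_.map_zero]
    ext ψ
    exact h ψ
  rw [map_sub, map_mul] at hψ
  have hK : ψ K ≠ 0 := fun h => hψ (by simp [h])
  have ht : ∀ a, ‖ψ (t a)‖ = 1 := fun a => by
    have h1 : star (t a) * t a = 1 := Subtype.ext (hT.star_mul_self a)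
    have h2 := congrArg ψ h1
    rw [map_mul, map_star, map_one] at h2
    have h3 := congrArg norm h2
    rw [norm_mul, norm_star, norm_one] at h3
    nlinarith [norm_nonneg (ψ (t a))]
  -- ψ is only norm continuous and `T` only strongly continuous; multiplying by `K` bridges the gap,
  -- and ψ K ≠ 0 can be divided out.
  have hcont : Continuous fun a => ψ (t a) := by
    have h1 : Continuous fun a => ψ (t a * K) := by
      refine (map_continuous ψ).comp (Continuous.subtype_mk ?_ _)
      exact hT.continuous_mul_integrated μ f
    have h2 : (fun a => ψ (t a)) = fun a => ψ (t a * K) / ψ K := by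
      funext a
      rw [map_mul, mul_div_cancel_right₀ _ hK]
    rw [h2]
    exact h1.div_const _
  refine ⟨fun a => ⟨ψ (t a), mem_sphere_zero_iff_norm.2 (ht a)⟩, hcont.subtype_mk _,
    fun a b => Subtype.ext ?_, fun h => hψ ?_⟩
  · exact (congrArg ψ (tadd a b)).trans (map_mul ψ _ _)
  · have h1 : ψ (t a₀) = 1 := congrArg Subtype.val h
    rw [h1, one_mul, sub_self]

end IsUnitaryRep
end Rep

/-! ### The translation representation on L²(G) -/

section Translation
variable {G : Type*} [AddCommGroup G] [TopologicalSpace G] [IsTopologicalAddGroup G]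
  [CompactSpace G] [MeasurableSpace G] [BorelSpace G]
  (μ : Measure G) [μ.IsAddLeftInvariant] [μ.IsOpenPosMeasure] [μ.Regular]

/-- Translation by `a` on `L²(G)`. -/
noncomputable def translationLp (a : G) : Lp ℂ 2 μ →L[ℂ] Lp ℂ 2 μ :=
  LinearMap.mkContinuous
    { toFun := fun g => DomAddAct.mk a +ᵥ g
      map_add' := fun g h => DomAddAct.vadd_Lp_add _ g h
      map_smul' := fun c g => by
        obtain ⟨⟨g⟩, hg⟩ := g
        rfl }
    1 (fun g => by
      change ‖DomAddAct.mk a +ᵥ g‖ ≤ 1 * ‖g‖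
      rw [DomAddAct.norm_vadd_Lp, one_mul])

theorem translationLp_apply (a : G) (g : Lp ℂ 2 μ) :
    translationLp μ a g = DomAddAct.mk a +ᵥ g := rfl

theorem isUnitaryRep_translationLp : IsUnitaryRep (translationLp μ) where
  map_zero := by
    ext1 g
    exact zero_vadd Gᵈᵃᵃ g
  map_add a b := by
    ext1 g
    change _ = DomAddAct.mk a +ᵥ (DomAddAct.mk b +ᵥ g)
    rw [vadd_vadd, translationLp_apply, add_comm a b]
    rfl
  norm_map a g := DomAddAct.norm_vadd_Lp _ g
  continuous_apply g := by
    have : Fact ((2 : ENNReal) ≠ ⊤) := ⟨by simp⟩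
    have : Continuous fun a : Gᵈᵃᵃ => a +ᵥ g := continuous_id.vadd continuous_const
    exact this.comp DomAddAct.continuous_mk

theorem translationLp_ne_one [T2Space G] {a : G} (ha : a ≠ 0) : translationLp μ a ≠ 1 := by
  intro h
  obtain ⟨U, V, hU, hV, h0, haV, hUV⟩ := t2_separation ha.symm
  -- `W` is a neighbourhood of 0 disjoint from its translate, so its indicator is not fixed.
  set W : Set G := U ∩ (a + ·) ⁻¹' V with hW
  have hWo : IsOpen W := hU.inter (hV.preimage (by fun_prop))
  have hW0 : (0 : G) ∈ W := ⟨h0, by simpa using haV⟩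
  have hne := hWo.measure_ne_zero μ ⟨0, hW0⟩
  have h1 := congrArg (fun R : Lp ℂ 2 μ →L[ℂ] Lp ℂ 2 μ =>
    R (indicatorConstLp 2 hWo.measurableSet (measure_ne_top μ W) (1 : ℂ))) h
  simp only [translationLp_apply, one_apply_eq_self] at h1
  rw [DomAddAct.mk_vadd_indicatorConstLp, indicatorConstLp_inj _ _ _ _ one_ne_zero] at h1
  have hd : Disjoint ((a +ᵥ ·) ⁻¹' W) W := by
    rw [Set.disjoint_left]
    rintro x ⟨hx1, -⟩ ⟨-, hx2⟩
    exact Set.disjoint_left.1 hUV hx1 hx2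
  have h2 := measure_congr (h1.inter (Filter.EventuallyEq.refl _ W))
  rw [Set.inter_self] at h2
  change μ ((a +ᵥ ·) ⁻¹' W ∩ W) = μ W at h2
  rw [hd.inter_eq, measure_empty] at h2
  exact hne h2.symm

end Translation

/-! ### A surjection onto the circle -/

theorem exists_character_ne_one {G : Type*} [AddCommGroup G] [TopologicalSpace G]
    [IsTopologicalAddGroup G] [CompactSpace G] [T2Space G] {a₀ : G} (ha₀ : a₀ ≠ 0) :
    ∃ χ : G → Circle, Continuous χ ∧ (∀ a b, χ (a + b) = χ a * χ b) ∧ χ a₀ ≠ 1 := by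
  borelize G
  let μ : Measure G := Measure.addHaarMeasure (⊤ : PositiveCompacts G)
  have : IsProbabilityMeasure μ := ⟨Measure.addHaarMeasure_self⟩
  exact (isUnitaryRep_translationLp μ).exists_character μ (translationLp_ne_one μ ha₀)
theorem exists_surjective_addCircle {G : Type*} [AddCommGroup G] [TopologicalSpace G]
    [IsTopologicalAddGroup G] [CompactSpace G] [T2Space G] [ConnectedSpace G] [Nontrivial G] :
    ∃ φ : G →+ UnitAddCircle, Continuous φ ∧ Function.Surjective φ := by
  obtain ⟨a₀, ha₀⟩ := exists_ne (0 : G)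
  obtain ⟨χ, hχ, hadd, hne⟩ := exists_character_ne_one ha₀
  let e := AddCircle.homeomorphCircle (one_ne_zero (α := ℝ))
  have he : ∀ x y, e (x + y) = e x * e y := fun x y => by
    simp only [e, AddCircle.homeomorphCircle_apply, AddCircle.toCircle_add]
  let φ : G →+ UnitAddCircle := AddMonoidHom.mk' (fun a => e.symm (χ a)) fun a b =>
    e.injective (by simp only [he, Homeomorph.apply_symm_apply, hadd])
  have hφ : Continuous φ := e.symm.continuous.comp hχ
  refine ⟨φ, hφ, ?_⟩
  have hdense : Dense (φ.range : Set UnitAddCircle) := by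
    -- A non-dense subgroup of the circle is finite cyclic; being connected, the image would be a
    -- point.
    rw [AddCircle.dense_addSubgroup_iff_ne_zmultiples]
    intro x hx hrange
    have hfin : (φ.range : Set UnitAddCircle).Finite := by
      rw [hrange, Set.Finite, SetLike.coe_sort_coe]
      exact finite_zmultiples.2 (addOrderOf_ne_zero_iff.1 hx)
    have hsub : (φ.range : Set UnitAddCircle).Subsingleton := by
      have hc : IsPreconnected (φ.range : Set UnitAddCircle) := by
        rw [AddMonoidHom.coe_range]
        exact isPreconnected_range hφ
      by_contra hns
      exact (hc.infinite_of_nontrivial (Set.not_subsingleton_iff.1 hns)) hfin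
    refine hne ?_
    have h0 : φ a₀ = 0 := hsub ⟨a₀, rfl⟩ (zero_mem _)
    have h1 : χ a₀ = e (φ a₀) := (e.apply_symm_apply _).symm
    rw [h1, h0, AddCircle.homeomorphCircle_apply, AddCircle.toCircle_zero]
  have hclosed : IsClosed (Set.range φ) := (isCompact_range hφ).isClosed
  rw [← Set.range_eq_univ, ← hclosed.closure_eq]
  exact (AddMonoidHom.coe_range φ ▸ hdense).closure_eq

/-! ### Sum-free arcs -/

theorem le_volume_image_Ioo (a : ℝ) {d : ℝ} (hd : d ≤ 1) :
    ENNReal.ofReal d ≤ volume ((↑) '' Set.Ioo a (a + d) : Set UnitAddCircle) := by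
  have ho : IsOpen ((↑) '' Set.Ioo a (a + d) : Set UnitAddCircle) :=
    QuotientAddGroup.isOpenMap_coe _ isOpen_Ioo
  rw [AddCircle.add_projection_respects_measure 1 a ho.measurableSet]
  refine le_trans (b := volume (Set.Ioo a (a + d))) (by simp) (measure_mono fun x hx => ?_)
  exact ⟨⟨x, hx, rfl⟩, hx.1, hx.2.le.trans (by linarith)⟩

theorem exists_real_sum_of_mem_kFoldSum_preimage_arc {G : Type*} [AddCommGroup G]
    (φ : G →+ UnitAddCircle) {k : ℕ} (hk : 1 ≤ k) {a d : ℝ} {x : G}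
    (hx : x ∈ kFoldSum k (φ ⁻¹' ((↑) '' Set.Ioo a (a + d)))) :
    ∃ u ∈ Set.Ioo (k * a) (k * (a + d)), (u : UnitAddCircle) = φ x := by
  obtain ⟨y, hy, rfl⟩ := hx
  choose u hu huy using hy
  have : Nonempty (Fin k) := ⟨⟨0, hk⟩⟩
  refine ⟨∑ i, u i, ⟨?_, ?_⟩, ?_⟩
  · calc (k : ℝ) * a = ∑ _i : Fin k, a := by simp
      _ < _ := Finset.sum_lt_sum_of_nonempty Finset.univ_nonempty fun i _ => (hu i).1
  · calc ∑ i, u i < ∑ _i : Fin k, (a + d) :=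
        Finset.sum_lt_sum_of_nonempty Finset.univ_nonempty fun i _ => (hu i).2
      _ = _ := by simp [mul_add]
  · rw [map_sum, ← Finset.sum_congr rfl fun i _ => huy i]
    exact map_sum (QuotientAddGroup.mk' (AddSubgroup.zmultiples (1 : ℝ))) u Finset.univ

theorem isSumFree_preimage_arc {G : Type*} [AddCommGroup G] (φ : G →+ UnitAddCircle) {k l : ℕ}
    (hk : 1 ≤ k) (hkl : k < l) :
    IsSumFree k l (φ ⁻¹' ((↑) '' Set.Ioo ((k : ℝ) / ((k + l) * (l - k)))
      ((k : ℝ) / ((k + l) * (l - k)) + 1 / (k + l)))) := by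
  have hk0 : (0 : ℝ) < k := by exact_mod_cast hk
  have hlk : (0 : ℝ) < l - k := sub_pos.2 (by exact_mod_cast hkl)
  have hs : (0 : ℝ) < k + l := by linarith
  set a : ℝ := (k : ℝ) / ((k + l) * (l - k)) with ha
  set d : ℝ := 1 / ((k : ℝ) + l) with hd
  have h1 : l * a = k * (a + d) := by rw [ha, hd]; field_simp; ring
  have h2 : (k + l) * d = 1 := by rw [hd]; field_simp
  rw [IsSumFree, Set.eq_empty_iff_forall_notMem]
  rintro x ⟨hxk, hxl⟩
  obtain ⟨u, hu, hux⟩ := exists_real_sum_of_mem_kFoldSum_preimage_arc φ hk hxk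
  obtain ⟨v, hv, hvx⟩ := exists_real_sum_of_mem_kFoldSum_preimage_arc φ (hk.trans hkl.le) hxl
  have h0 : ((v - u : ℝ) : UnitAddCircle) = 0 := by
    rw [AddCircle.coe_sub, hvx, hux, sub_self]
  obtain ⟨n, hn⟩ := (AddCircle.coe_eq_zero_iff 1).1 h0
  rw [zsmul_one] at hn
  -- The integer v - u lies strictly between la - k(a+d) = 0 and l(a+d) - ka = (k+l)d = 1.
  have h3 : (0 : ℝ) < n := by rw [hn]; linarith [hu.2, hv.1]
  have h4 : (n : ℝ) < 1 := by rw [hn]; linarith [hu.1, hv.2]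
  norm_cast at h3 h4
  lia

theorem lemma2p7 (k l : ℕ) (hk : 1 ≤ k) (hkl : k < l)
    (G : Type*) [AddCommGroup G] [TopologicalSpace G] [IsTopologicalAddGroup G]
    [CompactSpace G] [T2Space G] [ConnectedSpace G] [Nontrivial G]
    [MeasurableSpace G] [BorelSpace G] :
    1 / ((k : ℝ) + (l : ℝ)) ≤ sumFreeDensity k l G := by
  obtain ⟨φ, hφ, hsurj⟩ := exists_surjective_addCircle (G := G)
  have : IsProbabilityMeasure (haarProb G) := ⟨Measure.addHaarMeasure_self⟩
  have : (haarProb G).IsAddHaarMeasure := by unfold haarProb; infer_instance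
  have hmp : MeasurePreserving φ (haarProb G) volume :=
    -- Uniqueness of Haar measure: both total masses are 1.
    AddMonoidHom.measurePreserving hφ hsurj (by simp)
  set a : ℝ := (k : ℝ) / ((k + l) * (l - k)) with ha
  have hd : 1 / ((k : ℝ) + l) ≤ 1 := by
    have : (1 : ℝ) ≤ k := by exact_mod_cast hk
    exact div_le_one_of_le₀ (by linarith [Nat.cast_nonneg (α := ℝ) l]) (by positivity)
  set B : Set UnitAddCircle := (↑) '' Set.Ioo a (a + 1 / ((k : ℝ) + l)) with hB
  have hBm : MeasurableSet B := (QuotientAddGroup.isOpenMap_coe _ isOpen_Ioo).measurableSet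
  have hμ : 1 / ((k : ℝ) + l) ≤ (haarProb G).real (φ ⁻¹' B) := by
    rw [hmp.measureReal_preimage hBm.nullMeasurableSet]
    exact (ENNReal.ofReal_le_iff_le_toReal (measure_ne_top _ _)).1 (le_volume_image_Ioo a hd)
  refine hμ.trans (le_csSup ⟨1, ?_⟩ ⟨_, hφ.measurable hBm, isSumFree_preimage_arc φ hk hkl, rfl⟩)
  rintro r ⟨A, -, -, rfl⟩
  exact measureReal_le_one
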